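/- Let $M$ be a nonempty smooth $n$-dimensional manifold with a P-Sasakian structure $(\phi,\eta,\xi,g)$. This means: $\phi$ is a smooth $(1,1)$ tensor field, $\eta$ a smooth $1$-form, $\xi$ a smooth vector field and $g$ a Riemannian metric with Levi-Civita connection $\nabla$ such that $$\phi^2=I-\eta\otimes\xi,\quad \eta(\xi)=1,\quad \phi\xi=0,\quad \eta\circ\phi=0,\quad g(X,Y)=g(\phi X,\phi Y)+\eta(X)\eta(Y),$$ $$(\nabla_X\phi)Y=-g(X,Y)\xi-\eta(Y)X+2\eta(X)\eta(Y)\xi$$ for all vector fields $X,Y$. In the coordinates $(x^i,y^i)$ of $TM$ induced by coordinates $x^i$ of $M$, the vertical and complete lifts to $TM$ are $$X^v=X^i\tfrac{\partial}{\partial y^i},\qquad X^c=X^i\tfrac{\partial}{\partial x^i}+y^j\tfrac{\partial X^i}{\partial x^j}\tfrac{\partial}{\partial y^i},\qquad \eta^v=\eta_i\,dx^i,\qquad \eta^c=y^j\tfrac{\partial \eta_i}{\partial x^j}dx^i+\eta_i\,dy^i;$$ $\phi^c$ is the $(1,1)$ tensor field on $TM$ with $\phi^c(X^c)=(\phi X)^c$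 and $\phi^c(X^v)=(\phi X)^v$, and $\nabla^c$ is the linear connection on $TM$ with $\nabla^c_{X^c}Y^c=(\nabla_XY)^c$. Let $p,q$ be positive integers, $\sigma_{p,q}=\frac{p+\sqrt{p^2+4q}}2$, and $$J=\frac p2 I-\frac{2\sigma_{p,q}-p}{2}\left(\phi^c+\eta^v\otimes\xi^v+\eta^c\otimes\xi^c\right).$$ Theorem. If $n\ge 2$, then $J$ is not parallel with respect to $\nabla^c$, that is, $\nabla^cJ\neq0$. Explicitly (for every $n$), if $X$ is a smooth vector field on $M$ with $\eta(X)=0$, then $$(\nabla^c_{X^c}J)\xi^c=-\frac{2\sigma_{p,q}-p}{2}\left[(\phi X)^v-X^c\right]$$ on $TM$, and this is nonzero at every point of $TM$ lying over a point $x\in M$ with $X_x\ne0$; in particular it is not identically zero unless $X=0$. -/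

import Mathlib

open Bundle Manifold ContDiff

noncomputable section

namespace MetallicTangent

/-! ### Generalities: tensor fields, the flat derivative in preferred charts, `∇F` -/

section General

variable {E : Type*} [NormedAddCommGroup E] [NormedSpace ℝ E]
  {H : Type*} [TopologicalSpace H] {I : ModelWithCorners ℝ E H}
  {N : Type*} [TopologicalSpace N] [ChartedSpace H N]

/-- The components of a tangent vector at `x` in the coordinate frame of the preferred chart
at `x`. -/
def comps (x : N) : TangentSpace I x ≃L[ℝ] E := ContinuousLinearEquiv.refl ℝ E

variable [IsManifold I 1 N]

/-- Smooth vector fields. -/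
def SmoothField (X : ∀ x : N, TangentSpace I x) : Prop :=
  ContMDiff I I.tangent ∞ (fun x => (⟨x, X x⟩ : TangentBundle I N))

/-- Smooth tensor fields of type `(1,1)`. -/
def SmoothEndo (F : ∀ x : N, TangentSpace I x →L[ℝ] TangentSpace I x) : Prop :=
  ContMDiff I (I.prod 𝓘(ℝ, E →L[ℝ] E)) ∞
    (fun x => TotalSpace.mk' (E →L[ℝ] E)
      (E := fun x : N => TangentSpace I x →L[ℝ] TangentSpace I x) x (F x))

/-- Smooth `1`-forms. -/
def SmoothForm (η : ∀ x : N, TangentSpace I x →L[ℝ] ℝ) : Prop :=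
  ContMDiff I (I.prod 𝓘(ℝ, E →L[ℝ] ℝ)) ∞
    (fun x => TotalSpace.mk' (E →L[ℝ] ℝ)
      (E := fun x : N => TangentSpace I x →L[ℝ] Bundle.Trivial N ℝ x) x (η x))

/-- The component functions `z ↦ (Xⁱ(z))ᵢ` of the vector field `X` in the coordinate frame of the
preferred chart at `x₀`. -/
def fieldIn (x₀ : N) (X : ∀ x : N, TangentSpace I x) (z : N) : E :=
  (trivializationAt E (TangentSpace I) x₀ ⟨z, X z⟩).2

/-- The components of the tensor field `F` of type `(1,1)` in the coordinate frame of the preferred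
chart at `x₀`. -/
def endoIn (x₀ : N) (F : ∀ x : N, TangentSpace I x →L[ℝ] TangentSpace I x) (z : N) : E →L[ℝ] E :=
  ContinuousLinearMap.inCoordinates E (TangentSpace I : N → Type _) E (TangentSpace I : N → Type _)
    x₀ z x₀ z (F z)

/-- The components of the `1`-form `η` in the coordinate frame of the preferred chart at `x₀`. -/
def formIn (x₀ : N) (η : ∀ x : N, TangentSpace I x →L[ℝ] ℝ) (z : N) : E →L[ℝ] ℝ :=
  (η z).comp ((trivializationAt E (TangentSpace I : N → Type _) x₀).symmL ℝ z)

/-- The derivatives at `x` of the component functions of `X` in the preferred chart at `x`: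
`w ↦ (wʲ ∂ⱼXⁱ(x))ᵢ`. -/
def flatDeriv (X : ∀ x : N, TangentSpace I x) (x : N) : TangentSpace I x →L[ℝ] TangentSpace I x :=
  (comps (I := I) x).symm.toContinuousLinearMap.comp (mvfderiv I (fieldIn x X) x)

theorem fieldIn_add (x₀ : N) (X Y : ∀ x : N, TangentSpace I x) {z : N}
    (hz : z ∈ (trivializationAt E (TangentSpace I : N → Type _) x₀).baseSet) :
    fieldIn x₀ (X + Y) z = fieldIn x₀ X z + fieldIn x₀ Y z :=
  ((trivializationAt E (TangentSpace I : N → Type _) x₀).linear ℝ hz).map_add (X z) (Y z)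

theorem fieldIn_smul (x₀ : N) (f : N → ℝ) (X : ∀ x : N, TangentSpace I x) {z : N}
    (hz : z ∈ (trivializationAt E (TangentSpace I : N → Type _) x₀).baseSet) :
    fieldIn x₀ (f • X) z = f z • fieldIn x₀ X z :=
  ((trivializationAt E (TangentSpace I : N → Type _) x₀).linear ℝ hz).map_smul (f z) (X z)

theorem fieldIn_self (x : N) (X : ∀ x : N, TangentSpace I x) :
    fieldIn x X x = comps x (X x) :=
  (tangentBundleCore I N).coordChange_self (achart H x) x (mem_achart_source H x) (X x)

theorem flatDeriv_isCovariantDerivativeOn :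
    IsCovariantDerivativeOn (I := I) E
      (flatDeriv : (∀ x : N, TangentSpace I x) → ∀ x : N, TangentSpace I x →L[ℝ] TangentSpace I x) where
  add {X Y x} hX hY _ := by
    have hX' : MDifferentiableAt I 𝓘(ℝ, E) (fieldIn x X) x :=
      (mdifferentiableAt_section I X).1 hX
    have hY' : MDifferentiableAt I 𝓘(ℝ, E) (fieldIn x Y) x :=
      (mdifferentiableAt_section I Y).1 hY
    have h : fieldIn x (X + Y) =ᶠ[nhds x] fieldIn x X + fieldIn x Y := by
      filter_upwards [(trivializationAt E (TangentSpace I : N → Type _) x).open_baseSet.mem_nhds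
        (FiberBundle.mem_baseSet_trivializationAt' x)] with z hz
      exact fieldIn_add x X Y hz
    have h2 : mvfderiv I (fieldIn x (X + Y)) x = mvfderiv I (fieldIn x X + fieldIn x Y) x := by
      ext w
      simp only [mvfderiv, h.mfderiv_eq]
      rfl
    rw [flatDeriv, h2, mvfderiv_add hX' hY', ContinuousLinearMap.comp_add]
    rfl
  leibniz {X f x} hX hf _ := by
    have hX' : MDifferentiableAt I 𝓘(ℝ, E) (fieldIn x X) x :=
      (mdifferentiableAt_section I X).1 hX
    have h : fieldIn x (f • X) =ᶠ[nhds x] f • fieldIn x X := by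
      filter_upwards [(trivializationAt E (TangentSpace I : N → Type _) x).open_baseSet.mem_nhds
        (FiberBundle.mem_baseSet_trivializationAt' x)] with z hz
      exact fieldIn_smul x f X hz
    have h2 : mvfderiv I (fieldIn x (f • X)) x = mvfderiv I (f • fieldIn x X) x := by
      ext w
      simp only [mvfderiv, h.mfderiv_eq]
      rfl
    rw [flatDeriv, h2, mvfderiv_smul hf hX', fieldIn_self]
    ext w
    simp [flatDeriv]

/-- `flatDeriv` as a linear connection (with vanishing Christoffel symbols at each point `x`, in
the preferred chart at `x`). -/
def flat : CovariantDerivative I E (TangentSpace I : N → Type _) :=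
  ⟨flatDeriv, flatDeriv_isCovariantDerivativeOn⟩

/-- `(∇_w F) Y = ∇_w (F Y) - F (∇_w Y)` for a tangent vector `w` at `x`, a tensor field `F` of type
`(1,1)` and a vector field `Y`. -/
def nablaEndo (cov : CovariantDerivative I E (TangentSpace I : N → Type _))
    (F : ∀ x : N, TangentSpace I x →L[ℝ] TangentSpace I x)
    (x : N) (w : TangentSpace I x) (Y : ∀ x : N, TangentSpace I x) : TangentSpace I x :=
  cov (fun z => F z (Y z)) x w - F x (cov Y x w)

/-- The tensor field `F` of type `(1,1)` is parallel with respect to the connection: `∇F = 0`. -/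
def IsParallel (cov : CovariantDerivative I E (TangentSpace I : N → Type _))
    (F : ∀ x : N, TangentSpace I x →L[ℝ] TangentSpace I x) : Prop :=
  ∀ Y : (∀ x : N, TangentSpace I x), SmoothField Y →
    ∀ (x : N) (w : TangentSpace I x), nablaEndo cov F x w Y = 0

end General

/-! ### Lifts to the tangent bundle

A chart of `M` with coordinates `xⁱ` induces the chart of `TM` with coordinates `(xⁱ, yⁱ)`; the
preferred chart of `TM` at `v` is induced by the preferred chart of `M` at the foot point of `v`.
So a tangent vector to `TM` at `v` is written `aⁱ ∂/∂xⁱ + bⁱ ∂/∂yⁱ` with `(a, b) = comps v _`. -/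

section Lifts

variable {n : ℕ} {M : Type*} [TopologicalSpace M] [ChartedSpace (EuclideanSpace ℝ (Fin n)) M]
  [IsManifold (𝓡 n) ∞ M]

/-- The vertical lift `Xⁱ ∂/∂yⁱ` of a vector field. -/
def fieldV (X : ∀ x : M, TangentSpace (𝓡 n) x) (v : TangentBundle (𝓡 n) M) :
    TangentSpace (𝓡 n).tangent v :=
  (comps v).symm (0, comps v.proj (X v.proj))

/-- The complete lift `Xⁱ ∂/∂xⁱ + yʲ (∂Xⁱ/∂xʲ) ∂/∂yⁱ` of a vector field. -/
def fieldC (X : ∀ x : M, TangentSpace (𝓡 n) x) (v : TangentBundle (𝓡 n) M) :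
    TangentSpace (𝓡 n).tangent v :=
  (comps v).symm (comps v.proj (X v.proj), comps v.proj (flatDeriv X v.proj v.snd))

/-- The vertical lift `η ∘ π_* = ηᵢ dxⁱ` of a `1`-form. -/
def formV (η : ∀ x : M, TangentSpace (𝓡 n) x →L[ℝ] ℝ) (v : TangentBundle (𝓡 n) M) :
    TangentSpace (𝓡 n).tangent v →L[ℝ] ℝ :=
  ((η v.proj).comp ((comps v.proj).symm.toContinuousLinearMap.comp
    (ContinuousLinearMap.fst ℝ _ _))).comp (comps v).toContinuousLinearMap

/-- The complete lift `yʲ (∂ηᵢ/∂xʲ) dxⁱ + ηᵢ dyⁱ` of a `1`-form, characterized by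
`ηᶜ(Xᶜ) = (η(X))ᶜ`, `ηᶜ(Xᵛ) = (η(X))ᵛ`. -/
def formC (η : ∀ x : M, TangentSpace (𝓡 n) x →L[ℝ] ℝ) (v : TangentBundle (𝓡 n) M) :
    TangentSpace (𝓡 n).tangent v →L[ℝ] ℝ :=
  ((mvfderiv (𝓡 n) (formIn v.proj η) v.proj v.snd).comp (ContinuousLinearMap.fst ℝ _ _) +
    ((η v.proj).comp (comps v.proj).symm.toContinuousLinearMap).comp
      (ContinuousLinearMap.snd ℝ _ _)).comp (comps v).toContinuousLinearMap

/-- The complete lift of a tensor field `F` of type `(1,1)`, characterized by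
`Fᶜ(Xᶜ) = (F X)ᶜ`, `Fᶜ(Xᵛ) = (F X)ᵛ`. In components,
`Fᶜ (a, b) = (F a, yʲ (∂F/∂xʲ) a + F b)`. -/
def endoC (F : ∀ x : M, TangentSpace (𝓡 n) x →L[ℝ] TangentSpace (𝓡 n) x)
    (v : TangentBundle (𝓡 n) M) :
    TangentSpace (𝓡 n).tangent v →L[ℝ] TangentSpace (𝓡 n).tangent v :=
  let F₀ : EuclideanSpace ℝ (Fin n) →L[ℝ] EuclideanSpace ℝ (Fin n) :=
    ((comps v.proj).toContinuousLinearMap.comp (F v.proj)).comp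
      (comps v.proj).symm.toContinuousLinearMap
  (comps v).symm.toContinuousLinearMap.comp
    (((F₀.comp (ContinuousLinearMap.fst ℝ _ _)).prod
      ((mvfderiv (𝓡 n) (endoIn v.proj F) v.proj v.snd).comp (ContinuousLinearMap.fst ℝ _ _) +
        F₀.comp (ContinuousLinearMap.snd ℝ _ _))).comp (comps v).toContinuousLinearMap)

/-- The coordinate vector field `∂/∂xⁱ` of the preferred chart at `x₀`. -/
def coordField (x₀ : M) (i : Fin n) (z : M) : TangentSpace (𝓡 n) z :=
  (trivializationAt (EuclideanSpace ℝ (Fin n)) (TangentSpace (𝓡 n) : M → Type _) x₀).symmL ℝ z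
    (EuclideanSpace.single i 1)

/-- The Christoffel symbols of a linear connection in the preferred chart at `x₀`, as the bilinear
map `(B, a) ↦ aⁱ Bʲ Γᵢⱼᵏ ∂ₖ`, where `∇_{∂ᵢ} ∂ⱼ = Γᵢⱼᵏ ∂ₖ`. -/
def christoffel
    (cov : CovariantDerivative (𝓡 n) (EuclideanSpace ℝ (Fin n)) (TangentSpace (𝓡 n) : M → Type _))
    (x₀ z : M) : EuclideanSpace ℝ (Fin n) →L[ℝ] EuclideanSpace ℝ (Fin n) →L[ℝ]
      EuclideanSpace ℝ (Fin n) :=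
  ∑ j : Fin n, (EuclideanSpace.proj j : EuclideanSpace ℝ (Fin n) →L[ℝ] ℝ).smulRight
    (endoIn x₀ (cov (coordField x₀ j)) z)

/-- The Christoffel symbols at `v = (x, y)`, in the induced chart of `TM`, of the complete lift of a
linear connection, as the bilinear map sending `(A, B)` and the direction `(a, b)` to
`aⁱ Aʲ (Γᵢⱼᵏ ∂/∂xᵏ + yˡ (∂Γᵢⱼᵏ/∂xˡ) ∂/∂yᵏ) + (aⁱ Bʲ + bⁱ Aʲ) Γᵢⱼᵏ ∂/∂yᵏ`. -/
def christoffelC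
    (cov : CovariantDerivative (𝓡 n) (EuclideanSpace ℝ (Fin n)) (TangentSpace (𝓡 n) : M → Type _))
    (v : TangentBundle (𝓡 n) M) :
    (EuclideanSpace ℝ (Fin n) × EuclideanSpace ℝ (Fin n)) →L[ℝ]
      (EuclideanSpace ℝ (Fin n) × EuclideanSpace ℝ (Fin n)) →L[ℝ]
        (EuclideanSpace ℝ (Fin n) × EuclideanSpace ℝ (Fin n)) :=
  let Γ := christoffel cov v.proj v.proj
  let dΓ := mvfderiv (𝓡 n) (christoffel cov v.proj) v.proj v.snd
  LinearMap.toContinuousLinearMap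
    { toFun := fun Z =>
        ((Γ Z.1).comp (ContinuousLinearMap.fst ℝ _ _)).prod
          ((dΓ Z.1 + Γ Z.2).comp (ContinuousLinearMap.fst ℝ _ _) +
            (Γ Z.1).comp (ContinuousLinearMap.snd ℝ _ _))
      map_add' := fun Z W => by
        refine ContinuousLinearMap.ext fun c => ?_
        simp only [ContinuousLinearMap.prod_apply, add_apply,
          ContinuousLinearMap.comp_apply, Prod.fst_add, Prod.snd_add, map_add, Prod.mk_add_mk]
        congr 1
        abel
      map_smul' := fun r Z => by
        refine ContinuousLinearMap.ext fun c => ?_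
        simp [smul_add] }

/-- The complete lift `∇ᶜ` to `TM` of a linear connection `∇` on `M`: the connection whose
Christoffel symbols in induced charts are `christoffelC`. It is characterized by
`∇ᶜ_{Xᶜ} Yᶜ = (∇_X Y)ᶜ`. -/
def connC
    (cov : CovariantDerivative (𝓡 n) (EuclideanSpace ℝ (Fin n)) (TangentSpace (𝓡 n) : M → Type _)) :
    CovariantDerivative (𝓡 n).tangent (EuclideanSpace ℝ (Fin n) × EuclideanSpace ℝ (Fin n))
      (TangentSpace (𝓡 n).tangent : TangentBundle (𝓡 n) M → Type _) :=
  flat.addOneForm fun v =>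
    (comps v).symm.arrowCongr ((comps v).symm.arrowCongr (comps v).symm) (christoffelC cov v)

end Lifts

/-! ### P-Sasakian manifolds -/

section PSasakian

variable {n : ℕ} {M : Type*} [TopologicalSpace M] [ChartedSpace (EuclideanSpace ℝ (Fin n)) M]
  [IsManifold (𝓡 n) ∞ M]

/-- An almost paracontact structure `(φ, η, ξ)`. -/
structure IsAlmostParacontact
    (φ : ∀ x : M, TangentSpace (𝓡 n) x →L[ℝ] TangentSpace (𝓡 n) x)
    (η : ∀ x : M, TangentSpace (𝓡 n) x →L[ℝ] ℝ)
    (ξ : ∀ x : M, TangentSpace (𝓡 n) x) : Prop where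
  smooth_phi : SmoothEndo φ
  smooth_eta : SmoothForm η
  smooth_xi : SmoothField ξ
  phi_sq : ∀ (x : M) (w : TangentSpace (𝓡 n) x), φ x (φ x w) = w - η x w • ξ x
  eta_xi : ∀ x : M, η x (ξ x) = 1
  phi_xi : ∀ x : M, φ x (ξ x) = 0
  eta_phi : ∀ (x : M) (w : TangentSpace (𝓡 n) x), η x (φ x w) = 0

/-- `∇` is the Levi-Civita connection of the Riemannian metric `g`: the (smooth) linear connection
which is metric and torsion-free. -/
structure IsLeviCivita
    (g : ContMDiffRiemannianMetric (𝓡 n) ∞ (EuclideanSpace ℝ (Fin n))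
      (fun x : M => TangentSpace (𝓡 n) x))
    (cov : CovariantDerivative (𝓡 n) (EuclideanSpace ℝ (Fin n)) (TangentSpace (𝓡 n) : M → Type _)) :
    Prop where
  smooth : CovariantDerivative.ContMDiffCovariantDerivative cov ∞
  metric : ∀ Y Z : (∀ x : M, TangentSpace (𝓡 n) x), SmoothField Y → SmoothField Z →
    ∀ (x : M) (w : TangentSpace (𝓡 n) x),
      mvfderiv (𝓡 n) (fun z => g.inner z (Y z) (Z z)) x w =
        g.inner x (cov Y x w) (Z x) + g.inner x (Y x) (cov Z x w)
  torsion : cov.torsion = 0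

/-- `(φ, η, ξ, g)` is a P-Sasakian structure with Levi-Civita connection `∇`: an almost paracontact
structure with a compatible Riemannian metric such that
`(∇_w φ) Y = -g(w, Y) ξ - η(Y) w + 2 η(w) η(Y) ξ`. -/
structure IsPSasakian
    (φ : ∀ x : M, TangentSpace (𝓡 n) x →L[ℝ] TangentSpace (𝓡 n) x)
    (η : ∀ x : M, TangentSpace (𝓡 n) x →L[ℝ] ℝ)
    (ξ : ∀ x : M, TangentSpace (𝓡 n) x)
    (g : ContMDiffRiemannianMetric (𝓡 n) ∞ (EuclideanSpace ℝ (Fin n))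
      (fun x : M => TangentSpace (𝓡 n) x))
    (cov : CovariantDerivative (𝓡 n) (EuclideanSpace ℝ (Fin n)) (TangentSpace (𝓡 n) : M → Type _)) :
    Prop extends IsAlmostParacontact φ η ξ where
  compatible : ∀ (x : M) (u w : TangentSpace (𝓡 n) x),
    g.inner x u w = g.inner x (φ x u) (φ x w) + η x u * η x w
  leviCivita : IsLeviCivita g cov
  nabla_phi : ∀ Y : (∀ x : M, TangentSpace (𝓡 n) x), SmoothField Y →
    ∀ (x : M) (w : TangentSpace (𝓡 n) x),
      nablaEndo cov φ x w Y =
        -(g.inner x w (Y x) • ξ x) - η x (Y x) • w + (2 * η x w * η x (Y x)) • ξ x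

end PSasakian

/-! ### The metallic structure -/

section Metallic

variable {n : ℕ} {M : Type*} [TopologicalSpace M] [ChartedSpace (EuclideanSpace ℝ (Fin n)) M]
  [IsManifold (𝓡 n) ∞ M]

/-- The metallic mean `σ_{p,q} = (p + √(p² + 4q)) / 2`. -/
def metallicMean (p q : ℕ) : ℝ := (p + Real.sqrt ((p : ℝ) ^ 2 + 4 * q)) / 2

/-- `J = (p/2) I - ((2σ_{p,q} - p)/2) (φᶜ + ηᵛ ⊗ ξᵛ + ηᶜ ⊗ ξᶜ)`. -/
def metallicJ (p q : ℕ)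
    (φ : ∀ x : M, TangentSpace (𝓡 n) x →L[ℝ] TangentSpace (𝓡 n) x)
    (η : ∀ x : M, TangentSpace (𝓡 n) x →L[ℝ] ℝ)
    (ξ : ∀ x : M, TangentSpace (𝓡 n) x) (v : TangentBundle (𝓡 n) M) :
    TangentSpace (𝓡 n).tangent v →L[ℝ] TangentSpace (𝓡 n).tangent v :=
  ((p : ℝ) / 2) • ContinuousLinearMap.id ℝ (TangentSpace (𝓡 n).tangent v) -
    ((2 * metallicMean p q - p) / 2) •
      (endoC φ v + (formV η v).smulRight (fieldV ξ v) + (formC η v).smulRight (fieldC ξ v))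

end Metallic

end MetallicTangent

end

open MetallicTangent

/-! Everything is read off from the single field ξᶜ. Put c = (2σ - p)/2, and let w be a tangent
vector to TM with base component a. From φξ = 0 and η(ξ) = 1 one gets Jξᶜ = (p/2)ξᶜ - cξᵛ. The
P-Sasakian equation for Y = ξ, together with |ξ| = 1, gives ∇ξ = φ (`cov_xi`), so ∇ᶜ_w ξᶜ = φᶜw
(`connC_fieldC`) and ∇ᶜ_w ξᵛ = (φa)ᵛ (`comps_connC_fieldV`). Since η ∘ φ = 0, both ηᵛ and ηᶜ vanish
on φᶜw, hence J(φᶜw) = (p/2)φᶜw - c(φᶜ)²w. The terms (p/2)φᶜw cancel, and `endoC_endoC` yields (∇ᶜ_w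
J)ξᶜ = -c[(φa)ᵛ - w + ηᵛ(w)ξᶜ + ηᶜ(w)ξᵛ]. If η(a) = 0, the base component of the right side is ca,
and c > 0. For n ≥ 2 the kernel of η at a point contains some a ≠ 0.

Most of the work lies in the calculus of lifts. Lifts and ∇ᶜ are given pointwise, each in the
preferred chart at its own point, whereas derivatives need components in one fixed chart. A chart
change on TM is the tangent map of the chart change ψ on M, and in a chart Xᶜ is the tangent map of
the component function of X. The two fit together by the chain rule and the symmetry of D²ψ
(`fderiv_tanMap_tanMap`, `fieldIn_fieldC`). After that, each lift identity is the product rule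
applied to an identity on M written in one chart. -/

namespace MetallicTangent

/-! ### Derivatives, smoothness and change of components in charts -/

section Charts

variable {E : Type*} [NormedAddCommGroup E] [NormedSpace ℝ E]
  {H : Type*} [TopologicalSpace H] {I : ModelWithCorners ℝ E H} [I.Boundaryless]
  {N : Type*} [TopologicalSpace N] [ChartedSpace H N]
  {F : Type*} [NormedAddCommGroup F] [NormedSpace ℝ F]

/-- The derivative of a function in the preferred chart at the point. -/
theorem mvfderiv_eq_fderiv {f : N → F} {x : N} (hf : MDifferentiableAt I 𝓘(ℝ, F) f x)
    (w : TangentSpace I x) :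
    mvfderiv I f x w =
      fderiv ℝ (f ∘ (extChartAt I x).symm) (extChartAt I x x) (comps x w) := by
  simp only [mvfderiv, hf.mfderiv, writtenInExtChartAt, extChartAt_model_space_eq_id,
    ModelWithCorners.Boundaryless.range_eq_univ, fderivWithin_univ]
  rfl

variable [IsManifold I ∞ N]

theorem contMDiffAt_iff_contDiffAt_comp_symm {f : N → F} {x z : N} {k : ℕ∞}
    (hz : z ∈ (chartAt H x).source) :
    ContMDiffAt I 𝓘(ℝ, F) k f z ↔
      ContDiffAt ℝ k (f ∘ (extChartAt I x).symm) (extChartAt I x z) := by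
  have : IsManifold I k N := .of_le (n := ∞) (by exact_mod_cast le_top)
  rw [contMDiffAt_iff_source_of_mem_source (I := I) hz,
    ModelWithCorners.Boundaryless.range_eq_univ, contMDiffWithinAt_univ, contMDiffAt_iff_contDiffAt]

theorem contMDiffAt_field_iff {X : ∀ x : N, TangentSpace I x} {x z : N}
    (hz : z ∈ (chartAt H x).source) :
    ContMDiffAt I I.tangent ∞ (fun x => (⟨x, X x⟩ : TangentBundle I N)) z ↔
      ContDiffAt ℝ ∞ (fieldIn x X ∘ (extChartAt I x).symm) (extChartAt I x z) := by
  rw [← contMDiffAt_iff_contDiffAt_comp_symm (k := ⊤) hz]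
  exact Trivialization.contMDiffAt_section_iff (trivializationAt E (TangentSpace I : N → Type _) x)
    (by simpa using hz)

theorem SmoothField.contDiffAt {X : ∀ x : N, TangentSpace I x} (hX : SmoothField X) {x z : N}
    (hz : z ∈ (chartAt H x).source) :
    ContDiffAt ℝ ∞ (fieldIn x X ∘ (extChartAt I x).symm) (extChartAt I x z) :=
  (contMDiffAt_field_iff hz).1 (hX z)

omit [IsManifold I ∞ N] in
theorem eventually_symm_mem_source {x z : N} (hz : z ∈ (chartAt H x).source) (y : N)
    (hy : z ∈ (chartAt H y).source) :
    ∀ᶠ u in nhds (extChartAt I x z), u ∈ (extChartAt I x).target ∧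
      (extChartAt I x).symm u ∈ (chartAt H x).source ∧
      (extChartAt I x).symm u ∈ (chartAt H y).source := by
  have h1 : (extChartAt I x).target ∈ nhds (extChartAt I x z) :=
    extChartAt_target_mem_nhds' ((extChartAt I x).map_source (by simpa using hz))
  have h2 : ContinuousAt (extChartAt I x).symm (extChartAt I x z) :=
    continuousAt_extChartAt_symm' (by simpa using hz)
  have h3 := h2.preimage_mem_nhds (t := (chartAt H y).source) (by
    rw [(extChartAt I x).left_inv (by simpa using hz)]
    exact (chartAt H y).open_source.mem_nhds hy)
  filter_upwards [h1, h3] with u hu1 hu2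
  exact ⟨hu1, by simpa using (extChartAt I x).map_target hu1, hu2⟩

theorem hasFDerivAt_chart_change {x y z : N} (hx : z ∈ (chartAt H x).source)
    (hy : z ∈ (chartAt H y).source) :
    HasFDerivAt (extChartAt I y ∘ (extChartAt I x).symm) (tangentCoordChange I x y z)
      (extChartAt I x z) := by
  have := hasFDerivWithinAt_tangentCoordChange (I := I) (x := x) (y := y) (z := z)
    ⟨by simpa using hx, by simpa using hy⟩
  rwa [ModelWithCorners.Boundaryless.range_eq_univ, hasFDerivWithinAt_univ] at this

theorem contDiffAt_chart_change {x y z : N} (hx : z ∈ (chartAt H x).source)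
    (hy : z ∈ (chartAt H y).source) :
    ContDiffAt ℝ ∞ (extChartAt I y ∘ (extChartAt I x).symm) (extChartAt I x z) :=
  (contMDiffAt_iff_contDiffAt_comp_symm (k := ⊤) hx).1 (contMDiffAt_extChartAt' hy)

/-- With the transition map written as an `fderiv`, the chart change may be replaced by any function
agreeing with it near the point. On TM that function is a `tanMap`. -/
theorem fieldIn_chart_change {x y z : N} (hx : z ∈ (chartAt H x).source)
    (hy : z ∈ (chartAt H y).source) (X : ∀ x : N, TangentSpace I x) :
    fieldIn y X z = fderiv ℝ (extChartAt I y ∘ (extChartAt I x).symm) (extChartAt I x z)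
      (fieldIn x X z) := by
  rw [(hasFDerivAt_chart_change hx hy).fderiv]
  exact (tangentCoordChange_comp (I := I) (w := z) (x := x) (y := y) (z := z)
    ⟨⟨by simp, by simpa using hx⟩, by simpa using hy⟩).symm

end Charts

/-! ### Tangent maps between vector spaces -/

section TangentMap

variable {E F : Type*} [NormedAddCommGroup E] [NormedSpace ℝ E]
  [NormedAddCommGroup F] [NormedSpace ℝ F]

/-- The tangent map `(u, y) ↦ (f(u), Df(u) y)`. -/
noncomputable def tanMap (f : E → F) (p : E × E) : F × F := (f p.1, fderiv ℝ f p.1 p.2)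

theorem differentiableAt_fderiv {f : E → F} {u : E} (hf : ContDiffAt ℝ ∞ f u) :
    DifferentiableAt ℝ (fderiv ℝ f) u :=
  (hf.fderiv_right (m := ∞) le_rfl).differentiableAt (by simp)

theorem contDiffAt_tanMap {f : E → F} {p : E × E} (hf : ContDiffAt ℝ ∞ f p.1) :
    ContDiffAt ℝ ∞ (tanMap f) p := by
  have h1 : ContDiffAt ℝ ∞ (fun p : E × E => f p.1) p := hf.comp p contDiffAt_fst
  have h2 : ContDiffAt ℝ ∞ (fun p : E × E => fderiv ℝ f p.1) p :=
    (hf.fderiv_right (m := ∞) le_rfl).comp p contDiffAt_fst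
  exact h1.prodMk (h2.clm_apply contDiffAt_snd)

theorem fderiv_tanMap {f : E → F} {u y : E} (hf : ContDiffAt ℝ ∞ f u) (a b : E) :
    fderiv ℝ (tanMap f) (u, y) (a, b) =
      (fderiv ℝ f u a, fderiv ℝ (fderiv ℝ f) u a y + fderiv ℝ f u b) := by
  have h1 : HasFDerivAt (fun p : E × E => f p.1) _ (u, y) :=
    (hf.differentiableAt (by simp)).hasFDerivAt.comp (u, y) (hasFDerivAt_fst (p := (u, y)))
  have h2 : HasFDerivAt (fun p : E × E => fderiv ℝ f p.1) _ (u, y) :=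
    (differentiableAt_fderiv hf).hasFDerivAt.comp (u, y) (hasFDerivAt_fst (p := (u, y)))
  have h3 := h1.prodMk (h2.clm_apply (hasFDerivAt_snd (p := (u, y))))
  rw [HasFDerivAt.fderiv (f := tanMap f) h3]
  simp [add_comm]

theorem fderiv_fderiv_comm {f : E → F} {u : E} (hf : ContDiffAt ℝ ∞ f u) (a b : E) :
    fderiv ℝ (fderiv ℝ f) u a b = fderiv ℝ (fderiv ℝ f) u b a :=
  hf.isSymmSndFDerivAt (by
    rw [minSmoothness_of_isRCLikeNormedField]
    exact WithTop.coe_le_coe.2 (le_top : (2 : ℕ∞) ≤ ⊤)) a b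

/-- If vector fields `f'` and `f` on open sets are related by `ψ`, so are their complete lifts. -/
theorem fderiv_tanMap_tanMap {ψ f' f : E → E} {u : E} (hψ : ContDiffAt ℝ ∞ ψ u)
    (hf' : ContDiffAt ℝ ∞ f' u) (hf : ContDiffAt ℝ ∞ f (ψ u))
    (h : ∀ᶠ z in nhds u, f (ψ z) = fderiv ℝ ψ z (f' z)) (y : E) :
    fderiv ℝ (tanMap ψ) (u, y) (tanMap f' (u, y)) = tanMap f (tanMap ψ (u, y)) := by
  -- The relation is differentiated along y. This produces D²ψ(y, f'(u)), while `fderiv_tanMap`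
  -- produces D²ψ(f'(u), y); symmetry reconciles them.
  have h1 : fderiv ℝ (f ∘ ψ) u y = fderiv ℝ (fun z => fderiv ℝ ψ z (f' z)) u y := by
    rw [Filter.EventuallyEq.fderiv_eq (show f ∘ ψ =ᶠ[nhds u] _ from h)]
  rw [fderiv_comp u (hf.differentiableAt (by simp)) (hψ.differentiableAt (by simp)),
    fderiv_clm_apply (differentiableAt_fderiv hψ) (hf'.differentiableAt (by simp))] at h1
  simp only [tanMap, fderiv_tanMap hψ]
  refine Prod.ext h.self_of_nhds.symm ?_
  have h2 := fderiv_fderiv_comm hψ (f' u) y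
  simp only [ContinuousLinearMap.comp_apply, add_apply,
    ContinuousLinearMap.flip_apply] at h1
  rw [h1, h2, add_comm]

end TangentMap

/-! ### Induced charts of the tangent bundle -/

section TangentCharts

variable {E : Type*} [NormedAddCommGroup E] [NormedSpace ℝ E]
  {H : Type*} [TopologicalSpace H] {I : ModelWithCorners ℝ E H}
  {N : Type*} [TopologicalSpace N] [ChartedSpace H N] [IsManifold I ∞ N]

theorem extChartAt_tangent_apply (v w : TangentBundle I N) :
    extChartAt I.tangent v w =
      (extChartAt I v.proj w.proj, tangentCoordChange I w.proj v.proj w.proj (comps w.proj w.snd)) :=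
  rfl

theorem extChartAt_tangent_self (v : TangentBundle I N) :
    extChartAt I.tangent v v = (extChartAt I v.proj v.proj, comps v.proj v.snd) := by
  rw [extChartAt_tangent_apply, tangentCoordChange_self (by simp)]

variable [I.Boundaryless]

/-- The fibre coordinates of a tangent vector transform by the derivative of the chart change of M,
which is the second component of `tanMap`. -/
theorem tangent_chart_change_eventuallyEq {v v' w : TangentBundle I N}
    (hv' : w.proj ∈ (chartAt H v'.proj).source) (hv : w.proj ∈ (chartAt H v.proj).source) :
    extChartAt I.tangent v ∘ (extChartAt I.tangent v').symm =ᶠ[nhds (extChartAt I.tangent v' w)]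
      tanMap (extChartAt I v.proj ∘ (extChartAt I v'.proj).symm) := by
  filter_upwards [eventually_symm_mem_source (I := I.tangent) (x := v') (z := w)
    (by simpa using hv') v (by simpa using hv)] with p ⟨hp, hp1, hp2⟩
  have hq1 := (TangentBundle.mem_chart_source_iff _ _).1 hp1
  have hq2 := (TangentBundle.mem_chart_source_iff _ _).1 hp2
  have hr := (extChartAt I.tangent v').right_inv hp
  set q := (extChartAt I.tangent v').symm p with hq
  rw [extChartAt_tangent_apply] at hr
  have hpu : p.1 = extChartAt I v'.proj q.proj := by rw [← hr]
  have hpy : p.2 = tangentCoordChange I q.proj v'.proj q.proj (comps q.proj q.snd) := by rw [← hr]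
  rw [Function.comp_apply, ← hq, extChartAt_tangent_apply, tanMap, hpu, hpy,
    (hasFDerivAt_chart_change hq1 hq2).fderiv]
  refine Prod.ext ?_ ?_
  · rw [Function.comp_apply, (extChartAt I v'.proj).left_inv (by simpa using hq1)]
  · exact (tangentCoordChange_comp (I := I) ⟨⟨by simp, by simpa using hq1⟩, by simpa using hq2⟩).symm

end TangentCharts

/-! ### Lifted fields in a fixed chart -/

section Lifts

variable {n : ℕ} {M : Type*} [TopologicalSpace M] [ChartedSpace (EuclideanSpace ℝ (Fin n)) M]
  [IsManifold (𝓡 n) ∞ M]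

/-- Chart independence of the complete lift: the definition gives the formula at w in the chart of w
itself, and `fderiv_tanMap_tanMap` carries it to the chart of v. -/
theorem fieldIn_fieldC {X : ∀ x : M, TangentSpace (𝓡 n) x} (hX : SmoothField X)
    {v w : TangentBundle (𝓡 n) M}
    (hw : w.proj ∈ (chartAt (EuclideanSpace ℝ (Fin n)) v.proj).source) :
    fieldIn v (fieldC X) w =
      tanMap (fieldIn v.proj X ∘ (extChartAt (𝓡 n) v.proj).symm)
        (extChartAt (𝓡 n).tangent v w) := by
  have hww := mem_chart_source (EuclideanSpace ℝ (Fin n)) w.proj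
  have h0 : comps w (fieldC X w) =
      tanMap (fieldIn w.proj X ∘ (extChartAt (𝓡 n) w.proj).symm)
        (extChartAt (𝓡 n) w.proj w.proj, comps w.proj w.snd) := by
    refine Prod.ext ?_ ?_
    · simp only [tanMap, Function.comp_apply, extChartAt_to_inv, fieldIn_self]
      rfl
    · exact mvfderiv_eq_fderiv ((mdifferentiableAt_section (𝓡 n) X).1
        ((hX w.proj).mdifferentiableAt (by simp))) w.snd
  have h1 : extChartAt (𝓡 n).tangent v w =
      tanMap (extChartAt (𝓡 n) v.proj ∘ (extChartAt (𝓡 n) w.proj).symm)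
        (extChartAt (𝓡 n) w.proj w.proj, comps w.proj w.snd) := by
    have := (tangent_chart_change_eventuallyEq (v := v) (v' := w) (w := w) hww hw).self_of_nhds
    rwa [Function.comp_apply, extChartAt_to_inv, extChartAt_tangent_self] at this
  have h2 : fieldIn v (fieldC X) w =
      fderiv ℝ (tanMap (extChartAt (𝓡 n) v.proj ∘ (extChartAt (𝓡 n) w.proj).symm))
        (extChartAt (𝓡 n) w.proj w.proj, comps w.proj w.snd) (comps w (fieldC X w)) := by
    rw [fieldIn_chart_change (x := w) (y := v) (z := w) (by simp) (by simpa using hw),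
      fieldIn_self, (tangent_chart_change_eventuallyEq hww hw).fderiv_eq, extChartAt_tangent_self]
  rw [h2, h0, h1]
  refine fderiv_tanMap_tanMap (contDiffAt_chart_change hww hw) (hX.contDiffAt hww) ?_ ?_ _
  · simpa using hX.contDiffAt hw
  · filter_upwards [eventually_symm_mem_source (I := 𝓡 n) hww v.proj hw] with u ⟨hu, hu1, hu2⟩
    have := fieldIn_chart_change (I := 𝓡 n) hu1 hu2 X
    rw [(extChartAt (𝓡 n) w.proj).right_inv hu] at this
    rwa [Function.comp_apply, Function.comp_apply, Function.comp_apply,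
      (extChartAt (𝓡 n) v.proj).left_inv (by simpa using hu2)]

theorem fieldIn_fieldV (X : ∀ x : M, TangentSpace (𝓡 n) x)
    {v w : TangentBundle (𝓡 n) M}
    (hw : w.proj ∈ (chartAt (EuclideanSpace ℝ (Fin n)) v.proj).source) :
    fieldIn v (fieldV X) w = (0, fieldIn v.proj X w.proj) := by
  have hww := mem_chart_source (EuclideanSpace ℝ (Fin n)) w.proj
  rw [fieldIn_chart_change (x := w) (y := v) (z := w) (by simp) (by simpa using hw),
      fieldIn_self, (tangent_chart_change_eventuallyEq hww hw).fderiv_eq, extChartAt_tangent_self,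
      fieldIn_chart_change (x := w.proj) (y := v.proj) (z := w.proj) hww hw, fieldIn_self]
  refine (fderiv_tanMap (contDiffAt_chart_change hww hw) _ _).trans ?_
  simp

end Lifts

/-! ### Components of tensors, and the Leibniz rule for finite sums -/

section Components

variable {E : Type*} [NormedAddCommGroup E] [NormedSpace ℝ E]
  {H : Type*} [TopologicalSpace H] {I : ModelWithCorners ℝ E H}
  {N : Type*} [TopologicalSpace N] [ChartedSpace H N] [IsManifold I 1 N]

theorem fieldIn_eq_continuousLinearMapAt {x z : N} (hz : z ∈ (chartAt H x).source)
    (X : ∀ x : N, TangentSpace I x) :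
    fieldIn x X z =
      (trivializationAt E (TangentSpace I : N → Type _) x).continuousLinearMapAt ℝ z (X z) := by
  rw [Trivialization.continuousLinearMapAt_apply,
    Trivialization.coe_linearMapAt_of_mem _ (by simpa using hz)]
  rfl

theorem symmL_fieldIn {x z : N} (hz : z ∈ (chartAt H x).source)
    (X : ∀ x : N, TangentSpace I x) :
    (trivializationAt E (TangentSpace I : N → Type _) x).symmL ℝ z (fieldIn x X z) = X z := by
  rw [fieldIn_eq_continuousLinearMapAt hz, Trivialization.symmL_continuousLinearMapAt _
    (by simpa using hz)]

theorem fieldIn_symmL {x z : N} (hz : z ∈ (chartAt H x).source) (a : E) :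
    fieldIn x (fun z => (trivializationAt E (TangentSpace I : N → Type _) x).symmL ℝ z a) z = a := by
  rw [fieldIn_eq_continuousLinearMapAt hz, Trivialization.continuousLinearMapAt_symmL _
    (by simpa using hz)]

theorem endoIn_fieldIn {x z : N} (hz : z ∈ (chartAt H x).source)
    (F : ∀ x : N, TangentSpace I x →L[ℝ] TangentSpace I x) (X : ∀ x : N, TangentSpace I x) :
    endoIn x F z (fieldIn x X z) = fieldIn x (fun z => F z (X z)) z := by
  rw [endoIn, ContinuousLinearMap.inCoordinates, ContinuousLinearMap.comp_apply,
    ContinuousLinearMap.comp_apply, symmL_fieldIn hz, fieldIn_eq_continuousLinearMapAt hz]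

theorem formIn_fieldIn {x z : N} (hz : z ∈ (chartAt H x).source)
    (η : ∀ x : N, TangentSpace I x →L[ℝ] ℝ) (X : ∀ x : N, TangentSpace I x) :
    formIn x η z (fieldIn x X z) = η z (X z) := by
  rw [formIn, ContinuousLinearMap.comp_apply, symmL_fieldIn hz]

theorem endoIn_apply {x z : N} (hz : z ∈ (chartAt H x).source)
    (F : ∀ x : N, TangentSpace I x →L[ℝ] TangentSpace I x) (a : E) :
    endoIn x F z a = fieldIn x (fun z =>
      F z ((trivializationAt E (TangentSpace I : N → Type _) x).symmL ℝ z a)) z := by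
  rw [← endoIn_fieldIn hz, fieldIn_symmL hz]

theorem mvfderiv_symmL [I.Boundaryless] {F : Type*} [NormedAddCommGroup F] [NormedSpace ℝ F]
    {f : N → F} {x z : N}
    (hz : z ∈ (chartAt H x).source) (hf : MDifferentiableAt I 𝓘(ℝ, F) f z) (a : E) :
    mvfderiv I f z ((trivializationAt E (TangentSpace I : N → Type _) x).symmL ℝ z a) =
      fderiv ℝ (f ∘ (extChartAt I x).symm) (extChartAt I x z) a := by
  have hz' : z ∈ (extChartAt I x).source := by simpa using hz
  have h1 : MDifferentiableAt 𝓘(ℝ, E) I (extChartAt I x).symm (extChartAt I x z) := by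
    have := (contMDiffOn_extChartAt_symm (I := I) (n := 1) x).contMDiffAt
      (extChartAt_target_mem_nhds' ((extChartAt I x).map_source hz'))
    exact this.mdifferentiableAt one_ne_zero
  have hf' : MDifferentiableAt I 𝓘(ℝ, F) f ((extChartAt I x).symm (extChartAt I x z)) := by
    rwa [(extChartAt I x).left_inv hz']
  have h2 := mfderiv_comp (extChartAt I x z) hf' h1
  rw [mfderiv_eq_fderiv, (extChartAt I x).left_inv hz'] at h2
  rw [TangentBundle.symmL_trivializationAt hz, ModelWithCorners.Boundaryless.range_eq_univ,
    mfderivWithin_univ, h2]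
  rfl

/-- Differentiability of the partial sums travels with the formula through the induction, since
additivity of `cov` requires it. -/
theorem cov_sum_smul {ι : Type*} (cov : CovariantDerivative I E (TangentSpace I : N → Type _))
    (s : Finset ι) (f : ι → N → ℝ) (σ : ι → ∀ x : N, TangentSpace I x) {z : N}
    (hf : ∀ i, MDifferentiableAt I 𝓘(ℝ, ℝ) (f i) z)
    (hσ : ∀ i, MDifferentiableAt I I.tangent (fun x => (⟨x, σ i x⟩ : TangentBundle I N)) z) :
    MDifferentiableAt I I.tangent
      (fun x => (⟨x, (∑ i ∈ s, f i • σ i) x⟩ : TangentBundle I N)) z ∧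
    cov (∑ i ∈ s, f i • σ i) z =
      ∑ i ∈ s, (f i z • cov (σ i) z + (mvfderiv I (f i) z).smulRight (σ i z)) := by
  classical
  induction s using Finset.induction_on with
  | empty =>
    refine ⟨?_, ?_⟩
    · simpa using! mdifferentiableAt_zeroSection ℝ (TangentSpace I)
    · simp
  | insert i s hi ih =>
    have h := MDifferentiableAt.smul_section (hf i) (hσ i)
    rw [Finset.sum_insert hi, Finset.sum_insert hi]
    refine ⟨mdifferentiableAt_add_section h ih.1, ?_⟩
    rw [cov.isCovariantDerivativeOnUniv.add h ih.1, ih.2,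
      cov.isCovariantDerivativeOnUniv.leibniz (hσ i) (hf i)]

end Components

/-! ### The coordinate formula ∇X = DX + Γ(X) -/

section Christoffel

variable {n : ℕ} {M : Type*} [TopologicalSpace M] [ChartedSpace (EuclideanSpace ℝ (Fin n)) M]
  [IsManifold (𝓡 n) ∞ M]

theorem contMDiffAt_coordField {x z : M}
    (hz : z ∈ (chartAt (EuclideanSpace ℝ (Fin n)) x).source) (i : Fin n) :
    ContMDiffAt (𝓡 n) (𝓡 n).tangent ∞
      (fun z => (⟨z, coordField x i z⟩ : TangentBundle (𝓡 n) M)) z := by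
  rw [contMDiffAt_field_iff hz]
  refine (contDiffAt_const (c := EuclideanSpace.single i (1 : ℝ))).congr_of_eventuallyEq ?_
  filter_upwards [eventually_symm_mem_source (I := 𝓡 n) hz x hz] with u hu
  exact fieldIn_symmL hu.2.1 _

theorem sum_smul_coordField {x z : M}
    (hz : z ∈ (chartAt (EuclideanSpace ℝ (Fin n)) x).source)
    (X : ∀ x : M, TangentSpace (𝓡 n) x) :
    X z = (∑ i, (fun z => fieldIn x X z i) • coordField x i) z := by
  have h : fieldIn x X z = ∑ i, fieldIn x X z i • EuclideanSpace.single i (1 : ℝ) := by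
    ext j
    simp [Finset.sum_apply, Pi.single_apply]
  rw [← symmL_fieldIn hz X, h, map_sum, Finset.sum_apply]
  refine Finset.sum_congr rfl fun i _ => ?_
  rw [map_smul]
  rfl

/-- The Leibniz rule on X = Xⁱ∂ᵢ. The formula holds at every z of the chart domain, not only at its
centre, so that `connC_fieldC` can differentiate it once more. -/
theorem endoIn_cov
    (cov : CovariantDerivative (𝓡 n) (EuclideanSpace ℝ (Fin n)) (TangentSpace (𝓡 n) : M → Type _))
    {X : ∀ x : M, TangentSpace (𝓡 n) x} (hX : SmoothField X) {x z : M}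
    (hz : z ∈ (chartAt (EuclideanSpace ℝ (Fin n)) x).source) (a : EuclideanSpace ℝ (Fin n)) :
    endoIn x (cov X) z a =
      fderiv ℝ (fieldIn x X ∘ (extChartAt (𝓡 n) x).symm) (extChartAt (𝓡 n) x z) a +
        christoffel cov x z (fieldIn x X z) a := by
  have hf (i : Fin n) : MDifferentiableAt (𝓡 n) 𝓘(ℝ, ℝ) (fun z => fieldIn x X z i) z := by
    have h1 := (contMDiffAt_iff_contDiffAt_comp_symm (k := ⊤) hz).2 (hX.contDiffAt hz)
    have h2 : ContDiff ℝ ∞ (EuclideanSpace.proj i : EuclideanSpace ℝ (Fin n) →L[ℝ] ℝ) :=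
      ContinuousLinearMap.contDiff _
    exact (h2.contMDiff.contMDiffAt.comp z h1).mdifferentiableAt (by simp)
  obtain ⟨h1, h2⟩ := cov_sum_smul cov Finset.univ _ (coordField x) hf
    (fun i => (contMDiffAt_coordField hz i).mdifferentiableAt (by simp))
  -- The expansion in coordinate fields holds only on the chart domain; this suffices because `cov`
  -- depends only on germs.
  have h3 : cov X z = cov (∑ i, (fun z => fieldIn x X z i) • coordField x i) z := by
    refine cov.isCovariantDerivativeOnUniv.congr_of_eventuallyEq
      ((hX z).mdifferentiableAt (by simp)) h1 Filter.univ_mem ?_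
    filter_upwards [(chartAt (EuclideanSpace ℝ (Fin n)) x).open_source.mem_nhds hz] with w hw
    exact sum_smul_coordField hw X
  have hD := ((hX.contDiffAt hz).differentiableAt (by simp)).hasFDerivAt
  have h4 (i : Fin n) : mvfderiv (𝓡 n) (fun z => fieldIn x X z i) z
      ((trivializationAt (EuclideanSpace ℝ (Fin n)) (TangentSpace (𝓡 n) : M → Type _) x).symmL ℝ z a)
      = (fderiv ℝ (fieldIn x X ∘ (extChartAt (𝓡 n) x).symm) (extChartAt (𝓡 n) x z) a) i := by
    rw [mvfderiv_symmL hz (hf i)]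
    have := ((EuclideanSpace.proj i : EuclideanSpace ℝ (Fin n) →L[ℝ] ℝ).hasFDerivAt.comp _ hD).fderiv
    exact congrArg (fun L => L a) this
  rw [endoIn, ContinuousLinearMap.inCoordinates, h3, h2]
  simp only [ContinuousLinearMap.comp_apply, sum_apply, map_sum,
    add_apply, map_add, ContinuousLinearMap.smulRight_apply, h4, map_smul,
    Finset.sum_add_distrib]
  rw [add_comm]
  congr 1
  · ext j
    have (i : Fin n) := fieldIn_symmL (I := 𝓡 n) hz (EuclideanSpace.single i (1 : ℝ))
    simp only [fieldIn_eq_continuousLinearMapAt hz] at this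
    simp only [coordField, this]
    simp [Finset.sum_apply, Pi.single_apply]
  · simp only [christoffel, sum_apply, ContinuousLinearMap.smulRight_apply]
    refine Finset.sum_congr rfl fun i _ => ?_
    exact ((trivializationAt (EuclideanSpace ℝ (Fin n))
      (TangentSpace (𝓡 n) : M → Type _) x).continuousLinearMapAt ℝ z).map_smul _ _

end Christoffel

/-! ### Smoothness of components, and components at the centre of a chart -/

section Smoothness

variable {E : Type*} [NormedAddCommGroup E] [NormedSpace ℝ E]
  {H : Type*} [TopologicalSpace H] {I : ModelWithCorners ℝ E H}
  {N : Type*} [TopologicalSpace N] [ChartedSpace H N] [IsManifold I 1 N]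

theorem SmoothEndo.contMDiffAt_endoIn {F : ∀ x : N, TangentSpace I x →L[ℝ] TangentSpace I x}
    (hF : SmoothEndo F) (x : N) : ContMDiffAt I 𝓘(ℝ, E →L[ℝ] E) ∞ (endoIn x F) x :=
  ((contMDiffAt_hom_bundle _).1 (hF x)).2

theorem SmoothForm.contMDiffAt_formIn {η : ∀ x : N, TangentSpace I x →L[ℝ] ℝ}
    (hη : SmoothForm η) (x : N) : ContMDiffAt I 𝓘(ℝ, E →L[ℝ] ℝ) ∞ (formIn x η) x := by
  have h := ((contMDiffAt_hom_bundle _).1 (hη x)).2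
  refine h.congr_of_eventuallyEq (.of_forall fun z => ?_)
  ext a
  simp [formIn, ContinuousLinearMap.inCoordinates]

theorem SmoothField.comps_flatDeriv [I.Boundaryless] {X : ∀ x : N, TangentSpace I x}
    (hX : SmoothField X) (x : N) (w : TangentSpace I x) :
    comps x (flatDeriv X x w) =
      fderiv ℝ (fieldIn x X ∘ (extChartAt I x).symm) (extChartAt I x x) (comps x w) :=
  mvfderiv_eq_fderiv ((mdifferentiableAt_section I X).1 ((hX x).mdifferentiableAt (by simp))) w

theorem endoIn_self (x : N) (F : ∀ x : N, TangentSpace I x →L[ℝ] TangentSpace I x) (a : E) :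
    endoIn x F x a = comps x (F x ((comps x).symm a)) := by
  rw [endoIn_apply (mem_chart_source H x), fieldIn_self]
  have h := fieldIn_symmL (I := I) (mem_chart_source H x) a
  rw [fieldIn_self] at h
  rw [← h, ContinuousLinearEquiv.symm_apply_apply, h]

theorem formIn_self (x : N) (η : ∀ x : N, TangentSpace I x →L[ℝ] ℝ) (a : E) :
    formIn x η x a = η x ((comps x).symm a) := by
  have h := fieldIn_symmL (I := I) (mem_chart_source H x) a
  have h' := formIn_fieldIn (mem_chart_source H x) η
    (fun z => (trivializationAt E (TangentSpace I : N → Type _) x).symmL ℝ z a)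
  rw [h] at h'
  rw [fieldIn_self] at h
  rw [h', ← h, ContinuousLinearEquiv.symm_apply_apply, h]

end Smoothness

/-! ### Smoothness of Γ and of lifted fields; the complete lift of a connection -/

section Lifts

variable {n : ℕ} {M : Type*} [TopologicalSpace M] [ChartedSpace (EuclideanSpace ℝ (Fin n)) M]
  [IsManifold (𝓡 n) ∞ M]

/-- Smoothness of `cov` is applied to a globally smooth field, but ∂ᵢ is smooth only on the chart
domain. A bump function ψ equal to 1 near x makes it global without changing ∇∂ᵢ near x. -/
theorem contMDiffAt_endoIn_cov_coordField [T2Space M]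
    {cov : CovariantDerivative (𝓡 n) (EuclideanSpace ℝ (Fin n)) (TangentSpace (𝓡 n) : M → Type _)}
    (hcov : CovariantDerivative.ContMDiffCovariantDerivative cov ∞) (x : M) (i : Fin n) :
    ContMDiffAt (𝓡 n) 𝓘(ℝ, EuclideanSpace ℝ (Fin n) →L[ℝ] EuclideanSpace ℝ (Fin n)) ∞
      (endoIn x (cov (coordField x i))) x := by
  obtain ⟨ψ⟩ : Nonempty (SmoothBumpFunction (𝓡 n) x) := inferInstance
  have h1 : ContMDiff (𝓡 n) (𝓡 n).tangent ∞
      (fun z => (⟨z, ((ψ : M → ℝ) • coordField x i) z⟩ : TangentBundle (𝓡 n) M)) :=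
    ContMDiffOn.smul_section_of_tsupport ψ.contMDiff.contMDiffOn
      (chartAt (EuclideanSpace ℝ (Fin n)) x).open_source ψ.tsupport_subset_chartAt_source
      fun z hz => (contMDiffAt_coordField hz i).contMDiffWithinAt
  have h2 : SmoothEndo (cov ((ψ : M → ℝ) • coordField x i)) :=
    contMDiffOn_univ.1 (hcov.contMDiff.contMDiff h1.contMDiffOn)
  refine (h2.contMDiffAt_endoIn x).congr_of_eventuallyEq ?_
  -- At each z close to x, ψ must equal 1 on a neighbourhood of z, because ∇ at z sees the germ of
  -- the field there.
  filter_upwards [ψ.eventuallyEq_one.eventually_nhds,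
    (chartAt (EuclideanSpace ℝ (Fin n)) x).open_source.mem_nhds (mem_chart_source _ x)] with z hz hz'
  have h3 : cov (coordField x i) z = cov ((ψ : M → ℝ) • coordField x i) z := by
    refine cov.isCovariantDerivativeOnUniv.congr_of_eventuallyEq
      ((contMDiffAt_coordField hz' i).mdifferentiableAt (by simp))
      ((h1 z).mdifferentiableAt (by simp)) Filter.univ_mem ?_
    filter_upwards [hz] with w hw
    simp [hw]
  rw [endoIn, endoIn, h3]

theorem contMDiffAt_christoffel [T2Space M]
    {cov : CovariantDerivative (𝓡 n) (EuclideanSpace ℝ (Fin n)) (TangentSpace (𝓡 n) : M → Type _)}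
    (hcov : CovariantDerivative.ContMDiffCovariantDerivative cov ∞) (x : M) :
    ContMDiffAt (𝓡 n) 𝓘(ℝ, EuclideanSpace ℝ (Fin n) →L[ℝ] EuclideanSpace ℝ (Fin n) →L[ℝ]
      EuclideanSpace ℝ (Fin n)) ∞ (christoffel cov x) x := by
  have hx := mem_chart_source (EuclideanSpace ℝ (Fin n)) x
  refine (contMDiffAt_iff_contDiffAt_comp_symm (k := ⊤) hx).2 ?_
  have h (i : Fin n) := (contMDiffAt_iff_contDiffAt_comp_symm (k := ⊤) hx).1
    (contMDiffAt_endoIn_cov_coordField hcov x i)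
  exact ContDiffAt.sum (s := Finset.univ) (fun i _ => (contDiffAt_const (c := (EuclideanSpace.proj i :
    EuclideanSpace ℝ (Fin n) →L[ℝ] ℝ))).smulRight (h i))

theorem fieldIn_fieldC_comp_symm {X : ∀ x : M, TangentSpace (𝓡 n) x} (hX : SmoothField X)
    (v : TangentBundle (𝓡 n) M) :
    fieldIn v (fieldC X) ∘ (extChartAt (𝓡 n).tangent v).symm =ᶠ[nhds (extChartAt (𝓡 n).tangent v v)]
      tanMap (fieldIn v.proj X ∘ (extChartAt (𝓡 n) v.proj).symm) := by
  have hv := mem_chart_source (ModelProd (EuclideanSpace ℝ (Fin n)) (EuclideanSpace ℝ (Fin n))) v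
  filter_upwards [eventually_symm_mem_source (I := (𝓡 n).tangent) hv v hv] with p ⟨hp, hp1, _⟩
  rw [Function.comp_apply, fieldIn_fieldC hX ((TangentBundle.mem_chart_source_iff _ _).1 hp1),
    (extChartAt (𝓡 n).tangent v).right_inv hp]

theorem fieldIn_fieldV_comp_symm (X : ∀ x : M, TangentSpace (𝓡 n) x)
    (v : TangentBundle (𝓡 n) M) :
    fieldIn v (fieldV X) ∘ (extChartAt (𝓡 n).tangent v).symm =ᶠ[nhds (extChartAt (𝓡 n).tangent v v)]
      fun p => (0, (fieldIn v.proj X ∘ (extChartAt (𝓡 n) v.proj).symm) p.1) := by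
  have hv := mem_chart_source (ModelProd (EuclideanSpace ℝ (Fin n)) (EuclideanSpace ℝ (Fin n))) v
  filter_upwards [eventually_symm_mem_source (I := (𝓡 n).tangent) hv v hv] with p ⟨hp, hp1, _⟩
  rw [Function.comp_apply, fieldIn_fieldV X ((TangentBundle.mem_chart_source_iff _ _).1 hp1)]
  rfl

theorem SmoothField.fieldC {X : ∀ x : M, TangentSpace (𝓡 n) x} (hX : SmoothField X) :
    SmoothField (fieldC X) := fun v => by
  rw [contMDiffAt_field_iff (mem_chart_source _ v)]
  refine ContDiffAt.congr_of_eventuallyEq ?_ (fieldIn_fieldC_comp_symm hX v)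
  exact contDiffAt_tanMap (hX.contDiffAt (mem_chart_source _ _))

theorem SmoothField.fieldV {X : ∀ x : M, TangentSpace (𝓡 n) x} (hX : SmoothField X) :
    SmoothField (fieldV X) := fun v => by
  rw [contMDiffAt_field_iff (mem_chart_source _ v)]
  refine ContDiffAt.congr_of_eventuallyEq ?_ (fieldIn_fieldV_comp_symm X v)
  exact contDiffAt_const.prodMk
    (ContDiffAt.comp (f := Prod.fst) (extChartAt (𝓡 n).tangent v v)
      (hX.contDiffAt (mem_chart_source _ v.proj)) contDiffAt_fst)

theorem comps_flatDeriv_fieldC {X : ∀ x : M, TangentSpace (𝓡 n) x} (hX : SmoothField X)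
    (v : TangentBundle (𝓡 n) M) (w : TangentSpace (𝓡 n).tangent v) :
    comps v (flatDeriv (fieldC X) v w) =
      fderiv ℝ (tanMap (fieldIn v.proj X ∘ (extChartAt (𝓡 n) v.proj).symm))
        (extChartAt (𝓡 n) v.proj v.proj, comps v.proj v.snd) (comps v w) := by
  rw [← extChartAt_tangent_self, ← (fieldIn_fieldC_comp_symm hX v).fderiv_eq,
    hX.fieldC.comps_flatDeriv]

theorem comps_flatDeriv_fieldV {X : ∀ x : M, TangentSpace (𝓡 n) x} (hX : SmoothField X)
    (v : TangentBundle (𝓡 n) M) (w : TangentSpace (𝓡 n).tangent v) :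
    comps v (flatDeriv (fieldV X) v w) =
      (0, fderiv ℝ (fieldIn v.proj X ∘ (extChartAt (𝓡 n) v.proj).symm)
        (extChartAt (𝓡 n) v.proj v.proj) (comps v w).1) := by
  have h1 := ((hX.contDiffAt (mem_chart_source _ v.proj)).differentiableAt (by simp)).hasFDerivAt
  have h2 := (hasFDerivAt_const (0 : EuclideanSpace ℝ (Fin n)) _).prodMk
    (HasFDerivAt.comp (f := Prod.fst)
      (extChartAt (𝓡 n) v.proj v.proj, comps v.proj v.snd) h1 hasFDerivAt_fst)
  rw [hX.fieldV.comps_flatDeriv, (fieldIn_fieldV_comp_symm X v).fderiv_eq, extChartAt_tangent_self]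
  exact congrArg (fun L => L (comps v w)) h2.fderiv

theorem comps_endoC (F : ∀ x : M, TangentSpace (𝓡 n) x →L[ℝ] TangentSpace (𝓡 n) x)
    (v : TangentBundle (𝓡 n) M) (w : TangentSpace (𝓡 n).tangent v) :
    comps v (endoC F v w) = (endoIn v.proj F v.proj (comps v w).1,
      mvfderiv (𝓡 n) (endoIn v.proj F) v.proj v.snd (comps v w).1 +
        endoIn v.proj F v.proj (comps v w).2) := by
  rw [endoIn_self, endoIn_self]
  rfl

theorem comps_connC
    (cov : CovariantDerivative (𝓡 n) (EuclideanSpace ℝ (Fin n)) (TangentSpace (𝓡 n) : M → Type _))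
    (Z : ∀ v : TangentBundle (𝓡 n) M, TangentSpace (𝓡 n).tangent v)
    (v : TangentBundle (𝓡 n) M) (w : TangentSpace (𝓡 n).tangent v) :
    comps v (connC cov Z v w) = comps v (flatDeriv Z v w) +
      (christoffel cov v.proj v.proj (comps v (Z v)).1 (comps v w).1,
        mvfderiv (𝓡 n) (christoffel cov v.proj) v.proj v.snd (comps v (Z v)).1 (comps v w).1 +
          christoffel cov v.proj v.proj (comps v (Z v)).2 (comps v w).1 +
          christoffel cov v.proj v.proj (comps v (Z v)).1 (comps v w).2) :=
  rfl

theorem comps_fieldC {X : ∀ x : M, TangentSpace (𝓡 n) x} (hX : SmoothField X)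
    (v : TangentBundle (𝓡 n) M) :
    comps v (fieldC X v) = (fieldIn v.proj X v.proj,
      fderiv ℝ (fieldIn v.proj X ∘ (extChartAt (𝓡 n) v.proj).symm)
        (extChartAt (𝓡 n) v.proj v.proj) (comps v.proj v.snd)) := by
  rw [fieldIn_self, ← hX.comps_flatDeriv]
  rfl

theorem comps_fieldV (X : ∀ x : M, TangentSpace (𝓡 n) x) (v : TangentBundle (𝓡 n) M) :
    comps v (fieldV X v) = (0, fieldIn v.proj X v.proj) := by
  rw [fieldIn_self]
  rfl

/-- `∇ᶜ Xᶜ = (∇X)ᶜ`. -/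
theorem connC_fieldC [T2Space M]
    {cov : CovariantDerivative (𝓡 n) (EuclideanSpace ℝ (Fin n)) (TangentSpace (𝓡 n) : M → Type _)}
    (hcov : CovariantDerivative.ContMDiffCovariantDerivative cov ∞)
    {X : ∀ x : M, TangentSpace (𝓡 n) x} (hX : SmoothField X)
    (v : TangentBundle (𝓡 n) M) (w : TangentSpace (𝓡 n).tangent v) :
    connC cov (fieldC X) v w = endoC (cov X) v w := by
  apply (comps v).injective
  have hx := mem_chart_source (EuclideanSpace ℝ (Fin n)) v.proj
  have hX' := hX.contDiffAt hx
  have hΓ := contMDiffAt_christoffel hcov v.proj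
  have hΓ' := ((contMDiffAt_iff_contDiffAt_comp_symm (k := ⊤) hx).1 hΓ).differentiableAt (by simp)
  have hF : SmoothEndo (cov X) := contMDiffOn_univ.1 (hcov.contMDiff.contMDiff hX.contMDiffOn)
  -- The coordinate formula near the base point; its derivative along y supplies the vertical part
  -- of (∇X)ᶜ.
  have h1 : endoIn v.proj (cov X) ∘ (extChartAt (𝓡 n) v.proj).symm
      =ᶠ[nhds (extChartAt (𝓡 n) v.proj v.proj)] fun u =>
      fderiv ℝ (fieldIn v.proj X ∘ (extChartAt (𝓡 n) v.proj).symm) u +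
        (christoffel cov v.proj ∘ (extChartAt (𝓡 n) v.proj).symm) u
          ((fieldIn v.proj X ∘ (extChartAt (𝓡 n) v.proj).symm) u) := by
    filter_upwards [eventually_symm_mem_source (I := 𝓡 n) hx v.proj hx] with u hu
    ext1 a
    rw [Function.comp_apply, endoIn_cov cov hX hu.2.1, (extChartAt (𝓡 n) v.proj).right_inv hu.1]
    rfl
  rw [comps_connC, comps_flatDeriv_fieldC hX, comps_fieldC hX, comps_endoC,
    mvfderiv_eq_fderiv (hΓ.mdifferentiableAt (by simp)),
    mvfderiv_eq_fderiv ((hF.contMDiffAt_endoIn v.proj).mdifferentiableAt (by simp)), h1.fderiv_eq,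
    fderiv_fun_add (differentiableAt_fderiv hX')
      (hΓ'.clm_apply (hX'.differentiableAt (by simp))),
    fderiv_clm_apply hΓ' (hX'.differentiableAt (by simp)), endoIn_cov cov hX hx,
    endoIn_cov cov hX hx]
  generalize comps v w = c
  obtain ⟨a, b⟩ := c
  -- ∇ᶜXᶜ contains D²X(a, y) and (∇X)ᶜ contains D²X(y, a).
  rw [fderiv_tanMap hX', fderiv_fderiv_comm hX' a]
  refine Prod.ext rfl ?_
  simp only [Prod.mk_add_mk, add_apply, ContinuousLinearMap.comp_apply,
    ContinuousLinearMap.flip_apply, Function.comp_apply, extChartAt_to_inv]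
  abel

/-- `∇ᶜ Xᵛ = (∇X)ᵛ`. -/
theorem comps_connC_fieldV
    (cov : CovariantDerivative (𝓡 n) (EuclideanSpace ℝ (Fin n)) (TangentSpace (𝓡 n) : M → Type _))
    {X : ∀ x : M, TangentSpace (𝓡 n) x} (hX : SmoothField X)
    (v : TangentBundle (𝓡 n) M) (w : TangentSpace (𝓡 n).tangent v) :
    comps v (connC cov (fieldV X) v w) = (0, endoIn v.proj (cov X) v.proj (comps v w).1) := by
  -- The base component of Xᵛ is 0, so of the Christoffel terms, derivative of Γ included, only
  -- Γ(X)a survives.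
  rw [comps_connC, comps_flatDeriv_fieldV hX, comps_fieldV, endoIn_cov cov hX
    (mem_chart_source _ _)]
  simp

end Lifts

/-! ### Complete lifts of tensors evaluated on complete lifts of fields -/

section Lifts

variable {n : ℕ} {M : Type*} [TopologicalSpace M] [ChartedSpace (EuclideanSpace ℝ (Fin n)) M]
  [IsManifold (𝓡 n) ∞ M]

theorem SmoothEndo.smoothField_apply {F : ∀ x : M, TangentSpace (𝓡 n) x →L[ℝ] TangentSpace (𝓡 n) x}
    (hF : SmoothEndo F) {X : ∀ x : M, TangentSpace (𝓡 n) x} (hX : SmoothField X) :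
    SmoothField (fun z => F z (X z)) :=
  fun x => ContMDiffAt.clm_bundle_apply (hF x) (hX x)

theorem SmoothEndo.differentiableAt {F : ∀ x : M, TangentSpace (𝓡 n) x →L[ℝ] TangentSpace (𝓡 n) x}
    (hF : SmoothEndo F) (x : M) :
    DifferentiableAt ℝ (endoIn x F ∘ (extChartAt (𝓡 n) x).symm) (extChartAt (𝓡 n) x x) :=
  ((contMDiffAt_iff_contDiffAt_comp_symm (k := ⊤) (mem_chart_source _ x)).1
    (hF.contMDiffAt_endoIn x)).differentiableAt (by simp)

theorem SmoothForm.differentiableAt {η : ∀ x : M, TangentSpace (𝓡 n) x →L[ℝ] ℝ}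
    (hη : SmoothForm η) (x : M) :
    DifferentiableAt ℝ (formIn x η ∘ (extChartAt (𝓡 n) x).symm) (extChartAt (𝓡 n) x x) :=
  ((contMDiffAt_iff_contDiffAt_comp_symm (k := ⊤) (mem_chart_source _ x)).1
    (hη.contMDiffAt_formIn x)).differentiableAt (by simp)

theorem SmoothEndo.comps_endoC {F : ∀ x : M, TangentSpace (𝓡 n) x →L[ℝ] TangentSpace (𝓡 n) x}
    (hF : SmoothEndo F) (v : TangentBundle (𝓡 n) M) (w : TangentSpace (𝓡 n).tangent v) :
    comps v (endoC F v w) = (endoIn v.proj F v.proj (comps v w).1,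
      fderiv ℝ (endoIn v.proj F ∘ (extChartAt (𝓡 n) v.proj).symm) (extChartAt (𝓡 n) v.proj v.proj)
        (comps v.proj v.snd) (comps v w).1 + endoIn v.proj F v.proj (comps v w).2) := by
  rw [MetallicTangent.comps_endoC,
    mvfderiv_eq_fderiv ((hF.contMDiffAt_endoIn v.proj).mdifferentiableAt (by simp))]

theorem formV_apply (η : ∀ x : M, TangentSpace (𝓡 n) x →L[ℝ] ℝ)
    (v : TangentBundle (𝓡 n) M) (w : TangentSpace (𝓡 n).tangent v) :
    formV η v w = formIn v.proj η v.proj (comps v w).1 := by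
  rw [formIn_self]
  rfl

theorem SmoothForm.formC_apply {η : ∀ x : M, TangentSpace (𝓡 n) x →L[ℝ] ℝ}
    (hη : SmoothForm η) (v : TangentBundle (𝓡 n) M) (w : TangentSpace (𝓡 n).tangent v) :
    formC η v w =
      fderiv ℝ (formIn v.proj η ∘ (extChartAt (𝓡 n) v.proj).symm) (extChartAt (𝓡 n) v.proj v.proj)
        (comps v.proj v.snd) (comps v w).1 + formIn v.proj η v.proj (comps v w).2 := by
  rw [formIn_self,
    ← mvfderiv_eq_fderiv ((hη.contMDiffAt_formIn v.proj).mdifferentiableAt (by simp))]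
  rfl

omit [IsManifold (𝓡 n) ∞ M] in
-- Turns a tensor identity valid on a chart domain into an identity of derivatives; the algebraic
-- identities for complete lifts below rest on it.
theorem fderiv_eq_of_chart {F : Type*} [NormedAddCommGroup F] [NormedSpace ℝ F]
    {f g : EuclideanSpace ℝ (Fin n) → F} (x : M)
    (h : ∀ z ∈ (chartAt (EuclideanSpace ℝ (Fin n)) x).source,
      f (extChartAt (𝓡 n) x z) = g (extChartAt (𝓡 n) x z)) :
    fderiv ℝ f (extChartAt (𝓡 n) x x) = fderiv ℝ g (extChartAt (𝓡 n) x x) := by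
  apply Filter.EventuallyEq.fderiv_eq
  have hx := mem_chart_source (EuclideanSpace ℝ (Fin n)) x
  filter_upwards [eventually_symm_mem_source (I := 𝓡 n) hx x hx] with u hu
  have := h _ hu.2.1
  rwa [(extChartAt (𝓡 n) x).right_inv hu.1] at this

/-- `Fᶜ Xᶜ = (F X)ᶜ`. -/
theorem endoC_fieldC {F : ∀ x : M, TangentSpace (𝓡 n) x →L[ℝ] TangentSpace (𝓡 n) x}
    (hF : SmoothEndo F) {X : ∀ x : M, TangentSpace (𝓡 n) x} (hX : SmoothField X)
    (v : TangentBundle (𝓡 n) M) :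
    endoC F v (fieldC X v) = fieldC (fun z => F z (X z)) v := by
  apply (comps v).injective
  have hx := mem_chart_source (EuclideanSpace ℝ (Fin n)) v.proj
  have h := fderiv_eq_of_chart (n := n) v.proj
    (f := fieldIn v.proj (fun z => F z (X z)) ∘ (extChartAt (𝓡 n) v.proj).symm)
    (g := fun u => (endoIn v.proj F ∘ (extChartAt (𝓡 n) v.proj).symm) u
      ((fieldIn v.proj X ∘ (extChartAt (𝓡 n) v.proj).symm) u)) fun z hz => by
    simp only [Function.comp_apply]
    rw [(extChartAt (𝓡 n) v.proj).left_inv (by simpa using hz), endoIn_fieldIn hz]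
  rw [hF.comps_endoC, comps_fieldC hX, comps_fieldC (hF.smoothField_apply hX), h,
    fderiv_clm_apply (hF.differentiableAt _) ((hX.contDiffAt hx).differentiableAt (by simp)),
    endoIn_fieldIn hx]
  refine Prod.ext rfl ?_
  simp only [add_apply, ContinuousLinearMap.comp_apply, ContinuousLinearMap.flip_apply,
    Function.comp_apply, extChartAt_to_inv]
  abel

theorem formV_fieldC (η : ∀ x : M, TangentSpace (𝓡 n) x →L[ℝ] ℝ) (X : ∀ x : M, TangentSpace (𝓡 n) x)
    (v : TangentBundle (𝓡 n) M) : formV η v (fieldC X v) = η v.proj (X v.proj) :=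
  rfl

/-- If `η(X)` is constant then `ηᶜ(Xᶜ) = 0`. -/
theorem formC_fieldC {η : ∀ x : M, TangentSpace (𝓡 n) x →L[ℝ] ℝ} (hη : SmoothForm η)
    {X : ∀ x : M, TangentSpace (𝓡 n) x} (hX : SmoothField X) {c : ℝ}
    (h : ∀ x, η x (X x) = c) (v : TangentBundle (𝓡 n) M) : formC η v (fieldC X v) = 0 := by
  have hx := mem_chart_source (EuclideanSpace ℝ (Fin n)) v.proj
  -- The derivative along y of η(X) = c, expanded by the product rule, has ηᶜ(Xᶜ) as its left side.
  have h := fderiv_eq_of_chart (n := n) v.proj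
    (f := fun u => (formIn v.proj η ∘ (extChartAt (𝓡 n) v.proj).symm) u
      ((fieldIn v.proj X ∘ (extChartAt (𝓡 n) v.proj).symm) u)) (g := fun _ => c) fun z hz => by
    simp only [Function.comp_apply]
    rw [(extChartAt (𝓡 n) v.proj).left_inv (by simpa using hz), formIn_fieldIn hz, h]
  rw [fderiv_clm_apply (hη.differentiableAt _) ((hX.contDiffAt hx).differentiableAt (by simp)),
    fderiv_fun_const] at h
  have h' := congrArg (fun L => L (comps v.proj v.snd)) h
  simp only [add_apply, ContinuousLinearMap.comp_apply, ContinuousLinearMap.flip_apply,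
    Function.comp_apply, extChartAt_to_inv] at h'
  rw [hη.formC_apply, comps_fieldC hX, add_comm]
  exact h'

end Lifts

/-! ### Lifted almost paracontact identities -/

section Paracontact

variable {n : ℕ} {M : Type*} [TopologicalSpace M] [ChartedSpace (EuclideanSpace ℝ (Fin n)) M]
  [IsManifold (𝓡 n) ∞ M]
  {φ : ∀ x : M, TangentSpace (𝓡 n) x →L[ℝ] TangentSpace (𝓡 n) x}
  {η : ∀ x : M, TangentSpace (𝓡 n) x →L[ℝ] ℝ}
  {ξ : ∀ x : M, TangentSpace (𝓡 n) x}

namespace IsAlmostParacontact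

variable (h : IsAlmostParacontact φ η ξ)
include h

theorem formIn_endoIn {x z : M} (hz : z ∈ (chartAt (EuclideanSpace ℝ (Fin n)) x).source)
    (a : EuclideanSpace ℝ (Fin n)) : formIn x η z (endoIn x φ z a) = 0 := by
  rw [endoIn_apply hz, formIn_fieldIn hz, h.eta_phi]

theorem endoIn_endoIn {x z : M} (hz : z ∈ (chartAt (EuclideanSpace ℝ (Fin n)) x).source)
    (a : EuclideanSpace ℝ (Fin n)) :
    endoIn x φ z (endoIn x φ z a) = a - formIn x η z a • fieldIn x ξ z := by
  have h1 (X : ∀ x : M, TangentSpace (𝓡 n) x) :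
      endoIn x φ z (endoIn x φ z (fieldIn x X z)) =
        fieldIn x X z - formIn x η z (fieldIn x X z) • fieldIn x ξ z := by
    rw [endoIn_fieldIn hz, endoIn_fieldIn hz, formIn_fieldIn hz,
      fieldIn_eq_continuousLinearMapAt hz, h.phi_sq, map_sub, map_smul,
      fieldIn_eq_continuousLinearMapAt hz, fieldIn_eq_continuousLinearMapAt hz]
  -- An arbitrary vector a is realised as the components of the field that is constant in the chart.
  have h2 := h1 (fun z =>
    (trivializationAt (EuclideanSpace ℝ (Fin n)) (TangentSpace (𝓡 n) : M → Type _) x).symmL ℝ z a)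
  rwa [fieldIn_symmL hz] at h2

theorem formV_endoC (v : TangentBundle (𝓡 n) M) (w : TangentSpace (𝓡 n).tangent v) :
    formV η v (endoC φ v w) = 0 := by
  rw [formV_apply, h.smooth_phi.comps_endoC, h.formIn_endoIn (mem_chart_source _ _)]

theorem formC_endoC (v : TangentBundle (𝓡 n) M) (w : TangentSpace (𝓡 n).tangent v) :
    formC η v (endoC φ v w) = 0 := by
  have hx := mem_chart_source (EuclideanSpace ℝ (Fin n)) v.proj
  -- With the base component a of w frozen as a constant, the derivative of η(φa) = 0 along y gives
  -- the contribution of a to ηᶜ(φᶜw); that of the fibre component vanishes by η ∘ φ = 0 itself.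
  have h1 := fderiv_eq_of_chart (n := n) v.proj
    (f := fun u => (formIn v.proj η ∘ (extChartAt (𝓡 n) v.proj).symm) u
      ((endoIn v.proj φ ∘ (extChartAt (𝓡 n) v.proj).symm) u (comps v w).1)) (g := fun _ => 0)
    fun z hz => by
    simp only [Function.comp_apply]
    rw [(extChartAt (𝓡 n) v.proj).left_inv (by simpa using hz), h.formIn_endoIn hz]
  have hφ := h.smooth_phi.differentiableAt v.proj
  rw [fderiv_clm_apply (h.smooth_eta.differentiableAt _)
    (hφ.clm_apply (differentiableAt_const _)), fderiv_clm_apply hφ (differentiableAt_const _),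
    fderiv_fun_const] at h1
  have h2 := congrArg (fun L => L (comps v.proj v.snd)) h1
  simp only [add_apply, ContinuousLinearMap.comp_apply, ContinuousLinearMap.flip_apply,
    Function.comp_apply, extChartAt_to_inv, fderiv_fun_const, Pi.zero_apply,
    ContinuousLinearMap.comp_zero, zero_add] at h2
  rw [h.smooth_eta.formC_apply, h.smooth_phi.comps_endoC, map_add, h.formIn_endoIn hx, add_zero,
    add_comm]
  exact h2

/-- `(φᶜ)² = I - ηᵛ ⊗ ξᶜ - ηᶜ ⊗ ξᵛ`. -/
theorem endoC_endoC (v : TangentBundle (𝓡 n) M) (w : TangentSpace (𝓡 n).tangent v) :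
    endoC φ v (endoC φ v w) = w - formV η v w • fieldC ξ v - formC η v w • fieldV ξ v := by
  have hx := mem_chart_source (EuclideanSpace ℝ (Fin n)) v.proj
  apply (comps v).injective
  -- Again a is frozen: φ²a = a - η(a)ξ is differentiated along y to obtain the fibre part.
  have h1 := fderiv_eq_of_chart (n := n) v.proj
    (f := fun u => (endoIn v.proj φ ∘ (extChartAt (𝓡 n) v.proj).symm) u
      ((endoIn v.proj φ ∘ (extChartAt (𝓡 n) v.proj).symm) u (comps v w).1))
    (g := fun u => (comps v w).1 -
      (formIn v.proj η ∘ (extChartAt (𝓡 n) v.proj).symm) u (comps v w).1 •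
        (fieldIn v.proj ξ ∘ (extChartAt (𝓡 n) v.proj).symm) u)
    fun z hz => by
    simp only [Function.comp_apply]
    rw [(extChartAt (𝓡 n) v.proj).left_inv (by simpa using hz), h.endoIn_endoIn hz]
  have hφ := h.smooth_phi.differentiableAt v.proj
  have hη := h.smooth_eta.differentiableAt v.proj
  have hξ := (h.smooth_xi.contDiffAt hx).differentiableAt (by simp)
  rw [fderiv_clm_apply hφ (hφ.clm_apply (differentiableAt_const _)),
    fderiv_clm_apply hφ (differentiableAt_const _),
    fderiv_fun_sub (differentiableAt_const _)
      ((hη.clm_apply (differentiableAt_const _)).fun_smul hξ),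
    fderiv_fun_smul (hη.clm_apply (differentiableAt_const _)) hξ,
    fderiv_clm_apply hη (differentiableAt_const _), fderiv_fun_const] at h1
  have h2 := congrArg (fun L => L (comps v.proj v.snd)) h1
  simp only [add_apply, smul_apply, ContinuousLinearMap.comp_apply,
    ContinuousLinearMap.flip_apply, ContinuousLinearMap.smulRight_apply,
    Function.comp_apply, extChartAt_to_inv, Pi.zero_apply,
    ContinuousLinearMap.comp_zero, zero_add, zero_sub, neg_apply] at h2
  rw [h.smooth_phi.comps_endoC, h.smooth_phi.comps_endoC, map_sub, map_sub, map_smul, map_smul,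
    comps_fieldC h.smooth_xi, comps_fieldV, h.endoIn_endoIn hx, formV_apply,
    h.smooth_eta.formC_apply]
  refine Prod.ext ?_ ?_
  · simp
  · simp only [map_add, Prod.snd_sub, Prod.smul_snd, h.endoIn_endoIn hx]
    linear_combination (norm := module) h2

end IsAlmostParacontact

end Paracontact

/-! ### P-Sasakian geometry and the derivative of J -/

section PSasakian

variable {n : ℕ} {M : Type*} [TopologicalSpace M] [ChartedSpace (EuclideanSpace ℝ (Fin n)) M]
  [IsManifold (𝓡 n) ∞ M]
  {φ : ∀ x : M, TangentSpace (𝓡 n) x →L[ℝ] TangentSpace (𝓡 n) x}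
  {η : ∀ x : M, TangentSpace (𝓡 n) x →L[ℝ] ℝ}
  {ξ : ∀ x : M, TangentSpace (𝓡 n) x}
  {g : ContMDiffRiemannianMetric (𝓡 n) ∞ (EuclideanSpace ℝ (Fin n))
    (fun x : M => TangentSpace (𝓡 n) x)}
  {cov : CovariantDerivative (𝓡 n) (EuclideanSpace ℝ (Fin n)) (TangentSpace (𝓡 n) : M → Type _)}

namespace IsPSasakian

variable (h : IsPSasakian φ η ξ g cov)
include h

theorem inner_xi (x : M) (w : TangentSpace (𝓡 n) x) : g.inner x w (ξ x) = η x w := by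
  rw [h.compatible, h.phi_xi, map_zero, h.eta_xi, zero_add, mul_one]

/-- Since η = g(·, ξ), the left side is half the derivative of g(ξ, ξ) = 1. -/
theorem eta_cov_xi (x : M) (w : TangentSpace (𝓡 n) x) : η x (cov ξ x w) = 0 := by
  have h1 := h.leviCivita.metric ξ ξ h.smooth_xi h.smooth_xi x w
  have h2 : (fun z => g.inner z (ξ z) (ξ z)) = fun _ => (1 : ℝ) :=
    funext fun z => by rw [h.inner_xi, h.eta_xi]
  rw [h2, mvfderiv_const, g.symm x (ξ x), h.inner_xi] at h1
  have h3 : (0 : ℝ) = η x (cov ξ x w) + η x (cov ξ x w) := h1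
  linarith

/-- `∇ξ = φ`. -/
theorem cov_xi (x : M) : cov ξ x = φ x := by
  ext1 w
  have h1 := h.nabla_phi ξ h.smooth_xi x w
  have h2 : (fun z => φ z (ξ z)) = 0 := funext h.phi_xi
  rw [nablaEndo, h2, cov.zero, h.inner_xi, h.eta_xi] at h1
  have h3 : φ x (cov ξ x w) = w - η x w • ξ x := by
    have h4 : (0 : TangentSpace (𝓡 n) x) - φ x (cov ξ x w) =
      -(η x w • ξ x) - (1 : ℝ) • w + (2 * η x w * 1) • ξ x := h1
    linear_combination (norm := module) -h4
  -- Applying φ to φ(∇_wξ) = w - η(w)ξ gives φw on the right, and on the left ∇_wξ, which has no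
  -- ξ-component.
  have h5 := h.phi_sq x (cov ξ x w)
  rw [h.eta_cov_xi, h3, zero_smul, sub_zero, map_sub, map_smul, h.phi_xi, smul_zero, sub_zero] at h5
  exact h5.symm

end IsPSasakian

theorem metallicJ_apply (p q : ℕ) (v : TangentBundle (𝓡 n) M) (w : TangentSpace (𝓡 n).tangent v) :
    metallicJ p q φ η ξ v w = ((p : ℝ) / 2) • w - ((2 * metallicMean p q - p) / 2) •
      (endoC φ v w + formV η v w • fieldV ξ v + formC η v w • fieldC ξ v) :=
  rfl

theorem IsAlmostParacontact.metallicJ_fieldC_xi (h : IsAlmostParacontact φ η ξ) (p q : ℕ)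
    (v : TangentBundle (𝓡 n) M) :
    metallicJ p q φ η ξ v (fieldC ξ v) =
      ((p : ℝ) / 2) • fieldC ξ v - ((2 * metallicMean p q - p) / 2) • fieldV ξ v := by
  have h0 : comps v (fieldC (fun z => φ z (ξ z)) v) = 0 := by
    have h1 : (fun z => φ z (ξ z)) = 0 := funext h.phi_xi
    have h2 := (flat (I := 𝓡 n) (N := M)).zero
    rw [h1]
    refine Prod.ext rfl ?_
    exact congrArg (fun L => L v.proj v.snd) h2
  have h1 : fieldC (fun z => φ z (ξ z)) v = 0 := (comps v).injective (h0.trans (map_zero _).symm)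
  rw [metallicJ_apply, endoC_fieldC h.smooth_phi h.smooth_xi, h1, formV_fieldC, h.eta_xi,
    formC_fieldC h.smooth_eta h.smooth_xi h.eta_xi, zero_smul, one_smul, add_zero, zero_add]

set_option maxHeartbeats 1000000 in
-- Valid for every tangent vector w, not only for complete lifts, so a kernel vector of η at one
-- point need not be extended to a field. The vertical lift of φ sees only the base component of w.
theorem IsPSasakian.nablaEndo_metallicJ [T2Space M] (h : IsPSasakian φ η ξ g cov) (p q : ℕ)
    (v : TangentBundle (𝓡 n) M) (w : TangentSpace (𝓡 n).tangent v) :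
    nablaEndo (connC cov) (metallicJ p q φ η ξ) v w (fieldC ξ) =
      -(((2 * metallicMean p q - p) / 2) •
        ((comps v).symm (0, endoIn v.proj φ v.proj (comps v w).1) -
          (w - formV η v w • fieldC ξ v - formC η v w • fieldV ξ v))) := by
  have hC := (h.smooth_xi.fieldC v).mdifferentiableAt (by simp)
  have hV := (h.smooth_xi.fieldV v).mdifferentiableAt (by simp)
  have hcov : cov ξ = φ := funext h.cov_xi
  have h1 : (fun v => metallicJ p q φ η ξ v (fieldC ξ v)) =
      ((p : ℝ) / 2) • fieldC ξ + (-((2 * metallicMean p q - p) / 2)) • fieldV ξ :=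
    funext fun v => by
      rw [h.metallicJ_fieldC_xi, sub_eq_add_neg, ← neg_smul]
      rfl
  have h2 : connC cov (fieldV ξ) v w =
      (comps v).symm (0, endoIn v.proj φ v.proj (comps v w).1) := by
    rw [← hcov, ← comps_connC_fieldV cov h.smooth_xi, ContinuousLinearEquiv.symm_apply_apply]
  have h3 : connC cov (((p : ℝ) / 2) • fieldC ξ + (-((2 * metallicMean p q - p) / 2)) • fieldV ξ) v =
      ((p : ℝ) / 2) • connC cov (fieldC ξ) v +
        (-((2 * metallicMean p q - p) / 2)) • connC cov (fieldV ξ) v := by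
    rw [(connC cov).isCovariantDerivativeOnUniv.add
        (MDifferentiableAt.smul_const_section hC) (MDifferentiableAt.smul_const_section hV),
      (connC cov).isCovariantDerivativeOnUniv.smul_const _ hC,
      (connC cov).isCovariantDerivativeOnUniv.smul_const _ hV]
  have h4 : metallicJ p q φ η ξ v (endoC φ v w) = ((p : ℝ) / 2) • endoC φ v w -
      ((2 * metallicMean p q - p) / 2) •
        (w - formV η v w • fieldC ξ v - formC η v w • fieldV ξ v) := by
    rw [metallicJ_apply, h.endoC_endoC, h.formV_endoC, h.formC_endoC, zero_smul, zero_smul,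
      add_zero, add_zero]
  rw [nablaEndo, h1, h3, add_apply, smul_apply, smul_apply,
    h2, connC_fieldC h.leviCivita.smooth h.smooth_xi, hcov, h4]
  -- The term (p/2)φᶜw comes both from ∇ᶜ(Jξᶜ) and from J(∇ᶜξᶜ), and cancels.
  rw [smul_sub _ _ (w - _ - _), neg_smul]
  abel

/-- The coefficient equals √(p² + 4q)/2. -/
theorem metallicMean_coeff_pos (p q : ℕ) (hq : 0 < q) : 0 < (2 * metallicMean p q - p) / 2 := by
  have : 0 < Real.sqrt ((p : ℝ) ^ 2 + 4 * q) := Real.sqrt_pos.2 (by positivity)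
  rw [metallicMean]
  linarith

/-- Look at the base component: the lifts of φa and ξ are vertical and `hη` removes the ξᶜ term, so
only a positive multiple of the base component of w remains. -/
theorem IsPSasakian.nablaEndo_metallicJ_ne_zero [T2Space M] (h : IsPSasakian φ η ξ g cov)
    (p : ℕ) {q : ℕ} (hq : 0 < q) (v : TangentBundle (𝓡 n) M) (w : TangentSpace (𝓡 n).tangent v)
    (hw : (comps v w).1 ≠ 0) (hη : formV η v w = 0) :
    nablaEndo (connC cov) (metallicJ p q φ η ξ) v w (fieldC ξ) ≠ 0 := by
  rw [h.nablaEndo_metallicJ, hη, zero_smul, sub_zero]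
  intro h0
  have h1 := (smul_eq_zero.1 (neg_eq_zero.1 h0)).resolve_left (metallicMean_coeff_pos p q hq).ne'
  have h2 := congrArg (fun z => (comps v z).1) h1
  apply hw
  simp only [map_sub, map_smul, ContinuousLinearEquiv.apply_symm_apply, comps_fieldV, map_zero,
    Prod.fst_sub, Prod.smul_fst, smul_zero, zero_sub, sub_zero, Prod.fst_zero] at h2
  exact neg_eq_zero.1 h2

end PSasakian

end MetallicTangent

/-! ### The theorem -/

theorem mainTheorem4 {n : ℕ} {M : Type*} [TopologicalSpace M]
    [ChartedSpace (EuclideanSpace ℝ (Fin n)) M] [IsManifold (𝓡 n) ∞ M] [T2Space M]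
    (φ : ∀ x : M, TangentSpace (𝓡 n) x →L[ℝ] TangentSpace (𝓡 n) x)
    (η : ∀ x : M, TangentSpace (𝓡 n) x →L[ℝ] ℝ)
    (ξ : ∀ x : M, TangentSpace (𝓡 n) x)
    (g : ContMDiffRiemannianMetric (𝓡 n) ∞ (EuclideanSpace ℝ (Fin n))
      (fun x : M => TangentSpace (𝓡 n) x))
    (cov : CovariantDerivative (𝓡 n) (EuclideanSpace ℝ (Fin n)) (TangentSpace (𝓡 n) : M → Type _))
    (hM : IsPSasakian φ η ξ g cov)
    (p q : ℕ) (hp : 0 < p) (hq : 0 < q) :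
    (2 ≤ n → Nonempty M → ¬ IsParallel (connC cov) (metallicJ p q φ η ξ)) ∧
    ∀ X : (∀ x : M, TangentSpace (𝓡 n) x), SmoothField X → (∀ x, η x (X x) = 0) →
      (∀ v : TangentBundle (𝓡 n) M,
        nablaEndo (connC cov) (metallicJ p q φ η ξ) v (fieldC X v) (fieldC ξ) =
          -(((2 * metallicMean p q - p) / 2) •
            (fieldV (fun x => φ x (X x)) v - fieldC X v))) ∧
      (∀ v : TangentBundle (𝓡 n) M, X v.proj ≠ 0 →
        nablaEndo (connC cov) (metallicJ p q φ η ξ) v (fieldC X v) (fieldC ξ) ≠ 0) := by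
  refine ⟨fun hn ⟨x⟩ hpar => ?_, fun X hX hηX => ⟨fun v => ?_, fun v hv => ?_⟩⟩
  · let ηx : EuclideanSpace ℝ (Fin n) →ₗ[ℝ] ℝ := (formIn x η x).toLinearMap
    -- An injective functional would force n ≤ 1.
    obtain ⟨a, ha, ha0⟩ : ∃ a ∈ LinearMap.ker ηx, a ≠ 0 := by
      refine Submodule.exists_mem_ne_zero_of_ne_bot fun h0 => ?_
      have h1 := LinearMap.finrank_le_finrank_of_injective (LinearMap.ker_eq_bot.1 h0)
      rw [finrank_euclideanSpace_fin, Module.finrank_self] at h1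
      omega
    -- Any point over x and any w with base component a would do; zero is chosen for both fibre
    -- parts.
    let v : TangentBundle (𝓡 n) M := ⟨x, 0⟩
    refine hM.nablaEndo_metallicJ_ne_zero p hq v ((comps v).symm (a, 0)) ?_ ?_
      (hpar _ hM.smooth_xi.fieldC v _)
    · rwa [ContinuousLinearEquiv.apply_symm_apply]
    · rw [formV_apply, ContinuousLinearEquiv.apply_symm_apply]
      exact ha
  · rw [hM.nablaEndo_metallicJ, formV_fieldC, hηX, formC_fieldC hM.smooth_eta hX hηX, zero_smul,
      zero_smul, sub_zero, sub_zero, comps_fieldC hX,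
      endoIn_fieldIn (mem_chart_source _ _), ← comps_fieldV,
      ContinuousLinearEquiv.symm_apply_apply]
  · exact hM.nablaEndo_metallicJ_ne_zero p hq v _ hv (hηX v.proj)
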